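/- Theorem 2 (control of dependent coordinates). Consider the constrained mechanical system $$M(q)\ddot q + C(q,\dot q)\dot q = f_g(q) + f_c + f,\qquad A(q)\dot q = 0,\qquad q\in\mathbb R^n,$$ where $M(q)\in\mathbb R^{n\times n}$ is symmetric positive definite and continuously differentiable in $q$, the matrix $\dot M-2C$ is skew-symmetric, $A(q)\in\mathbb R^{m\times n}$ is the (possibly rank-deficient) constraint matrix, the constraint force satisfies $f_c\in\mathcal N(A(q))^{\perp}$, and the input force has the form $f=B(q)u$ with $B(q)\in\mathbb R^{n\times k}$. Let $P(q)$ be the orthogonal projection onto the null space $\mathcal N(A(q))$, and assume that for every $q$ $$\mathcal R(P(q)B(q))=\mathcal N(A(q))\quad\text{or}\quad \mathcal N(A(q))\subseteq\mathcal R(B(q)).$$ Let $R=B\,\Gamma$ with $\Gamma=(PB)^+$ the Moore–Penrose pseudo-inverse, so that $R=B(B^TPB)^{-1}B^TP$ whenever $B^TPB$ is invertible. Let $q^*\in\mathbb R^n$, $e=q-q^*$, let $K_p>0$, $K_d>0$ and $\sigma>1$ be real numbers, and apply the control law $$f=-R(q)\Big(f_g(q)+K_p\big(e+\sigma\|e\|\,\eta\big)+K_d\,\dot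 q\Big),\qquad \eta=\begin{cases}\dot q/\|\dot q\| & \text{if } \dot q\neq 0,\\ \xi & \text{if } \dot q=0,\end{cases}$$ where $\xi$ is a unit vector in $\mathcal N(A)$, either constant or depending only on the configuration, $\xi=\xi(q)\in\mathcal N(A(q))$ for every $q$. Then every motion $q(t)$ of the closed-loop system that is defined for all $t\ge 0$ (in the sense of Carathéodory: $\dot q$ is locally absolutely continuous, $A(q)\dot q=0$ for all $t\ge0$, and the equation of motion holds for almost every $t\ge0$) satisfies $q(t)\to q^*$ and $\dot q(t)\to 0$ as $t\to\infty$. -/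

import Mathlib

open Filter Topology MeasureTheory

noncomputable section

namespace ConstrainedControl

/-- `ℝⁿ` with the Euclidean norm. -/
abbrev Vec (n : ℕ) : Type := EuclideanSpace ℝ (Fin n)

/-- The product of a matrix with a column vector. -/
abbrev act {m n : ℕ} (X : Matrix (Fin m) (Fin n) ℝ) (x : Vec n) : Vec m :=
  Matrix.toEuclideanLin X x

/-- The null space of a matrix. -/
def nullSpace {m n : ℕ} (X : Matrix (Fin m) (Fin n) ℝ) : Submodule ℝ (Vec n) :=
  LinearMap.ker (Matrix.toEuclideanLin X)

/-- The range (column) space of a matrix. -/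
def rangeSpace {m n : ℕ} (X : Matrix (Fin m) (Fin n) ℝ) : Submodule ℝ (Vec m) :=
  LinearMap.range (Matrix.toEuclideanLin X)

/-- The matrix of the orthogonal projection onto the null space of `A`. -/
def nullProj {m n : ℕ} (A : Matrix (Fin m) (Fin n) ℝ) : Matrix (Fin n) (Fin n) ℝ :=
  Matrix.toEuclideanLin.symm ((nullSpace A).starProjection : Vec n →ₗ[ℝ] Vec n)

lemma isCompl_nullSpace {m n : ℕ} (X : Matrix (Fin m) (Fin n) ℝ) :
    IsCompl (nullSpace X)ᗮ (LinearMap.ker (Matrix.toEuclideanLin X)) :=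
  (Submodule.isCompl_orthogonal (nullSpace X)).symm

/-- The Moore–Penrose pseudo-inverse `X⁺`: a vector is projected orthogonally onto the range of
`X` and then mapped to the unique preimage that is orthogonal to the null space of `X`
(the least-squares solution of minimal norm). -/
def pinv {m n : ℕ} (X : Matrix (Fin m) (Fin n) ℝ) : Matrix (Fin n) (Fin m) ℝ :=
  Matrix.toEuclideanLin.symm
    ((nullSpace X)ᗮ.subtype ∘ₗ
      ((Matrix.toEuclideanLin X).kerComplementEquivRange (isCompl_nullSpace X)).symm.toLinearMap ∘ₗ
      ((LinearMap.range (Matrix.toEuclideanLin X)).orthogonalProjectionOnto :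
        Vec m →ₗ[ℝ] LinearMap.range (Matrix.toEuclideanLin X)))

/-- The oblique projection `R = B Γ`, where `P` is the orthogonal projection onto the null space of
`A` and `Γ = (P B)⁺`. It equals `B (Bᵀ P B)⁻¹ Bᵀ P` whenever `Bᵀ P B` is invertible
(see `obliqueProj_eq`); the pseudo-inverse gives the same operator a meaning for redundant
actuation and at singular configurations. -/
def obliqueProj {m n k : ℕ} (A : Matrix (Fin m) (Fin n) ℝ) (B : Matrix (Fin n) (Fin k) ℝ) :
    Matrix (Fin n) (Fin n) ℝ :=
  B * pinv (nullProj A * B)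

lemma toEuclideanLin_mul_pinv {m n : ℕ} (X : Matrix (Fin m) (Fin n) ℝ) :
    Matrix.toEuclideanLin (X * pinv X) =
      ((LinearMap.range (Matrix.toEuclideanLin X)).starProjection : Vec m →ₗ[ℝ] Vec m) := by
  apply LinearMap.ext
  intro y
  rw [Matrix.toLpLin_mul (q := 2), pinv, LinearEquiv.apply_symm_apply]
  exact congrArg Subtype.val
    (((Matrix.toEuclideanLin X).kerComplementEquivRange (isCompl_nullSpace X)).apply_symm_apply
      ((LinearMap.range (Matrix.toEuclideanLin X)).orthogonalProjectionOnto y))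

lemma transpose_of_starProjection {n : ℕ} (Y : Matrix (Fin n) (Fin n) ℝ)
    (K : Submodule ℝ (Vec n))
    (h : Matrix.toEuclideanLin Y = (K.starProjection : Vec n →ₗ[ℝ] Vec n)) :
    Y.transpose = Y := by
  have hs : (Matrix.toEuclideanLin Y).IsSymmetric := by
    rw [h]; exact K.starProjection_isSymmetric
  have := (Matrix.isSymmetric_toEuclideanLin_iff.mp hs).eq
  rwa [Matrix.conjTranspose_eq_transpose_of_trivial] at this

lemma mul_pinv_mul {m n : ℕ} (X : Matrix (Fin m) (Fin n) ℝ) : X * pinv X * X = X := by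
  apply Matrix.toEuclideanLin.injective
  apply LinearMap.ext
  intro y
  rw [Matrix.toLpLin_mul (q := 2), toEuclideanLin_mul_pinv]
  exact Submodule.starProjection_eq_self_iff.mpr (LinearMap.mem_range_self _ y)

/-- If `Bᵀ P B` is invertible, the oblique projection is `B (Bᵀ P B)⁻¹ Bᵀ P`. -/
lemma obliqueProj_eq {m n k : ℕ} (A : Matrix (Fin m) (Fin n) ℝ) (B : Matrix (Fin n) (Fin k) ℝ)
    (h : IsUnit (B.transpose * nullProj A * B).det) :
    obliqueProj A B =
      B * (B.transpose * nullProj A * B)⁻¹ * B.transpose * nullProj A := by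
  have hP : (nullProj A).transpose = nullProj A :=
    transpose_of_starProjection _ (nullSpace A) (LinearEquiv.apply_symm_apply _ _)
  have hPP : nullProj A * nullProj A = nullProj A := by
    apply Matrix.toEuclideanLin.injective
    apply LinearMap.ext
    intro y
    rw [Matrix.toLpLin_mul (q := 2), nullProj, LinearEquiv.apply_symm_apply]
    exact Submodule.starProjection_eq_self_iff.mpr (Submodule.starProjection_apply_mem _ _)
  set P := nullProj A with hPdef
  have hX : (P * B).transpose * (P * B) = B.transpose * P * B := by
    rw [Matrix.transpose_mul, hP, Matrix.mul_assoc, ← Matrix.mul_assoc P P B, hPP,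
      Matrix.mul_assoc]
  have hsym := transpose_of_starProjection _ _ (toEuclideanLin_mul_pinv (P * B))
  have hkey : (P * B).transpose * (P * B) * pinv (P * B) = (P * B).transpose := by
    rw [Matrix.mul_assoc]
    calc (P * B).transpose * (P * B * pinv (P * B))
        = (P * B).transpose * (P * B * pinv (P * B)).transpose := by rw [hsym]
      _ = (P * B).transpose := by rw [← Matrix.transpose_mul, mul_pinv_mul]
  have hpinv : pinv (P * B) = (B.transpose * P * B)⁻¹ * (B.transpose * P) := by
    rw [hX, Matrix.transpose_mul, hP] at hkey
    calc pinv (P * B)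
        = (B.transpose * P * B)⁻¹ * (B.transpose * P * B) * pinv (P * B) := by
          rw [Matrix.nonsing_inv_mul _ h, Matrix.one_mul]
      _ = (B.transpose * P * B)⁻¹ * (B.transpose * P) := by rw [Matrix.mul_assoc, hkey]
  rw [obliqueProj, ← hPdef, hpinv]
  simp only [Matrix.mul_assoc]

/-- The directional derivative at `q` along `v` of a matrix-valued function, entry by entry.
Along a motion `q(t)` this is `d/dt M(q(t))` for `v` the generalized velocity. -/
def matDeriv {n : ℕ} (M : Vec n → Matrix (Fin n) (Fin n) ℝ) (q v : Vec n) :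
    Matrix (Fin n) (Fin n) ℝ :=
  Matrix.of fun i j => fderiv ℝ (fun x => M x i j) q v

/-- The data of a constrained mechanical system with `n` generalized coordinates, `m` Pfaffian
constraints (possibly redundant, of varying rank) and `k` actuators. -/
structure ConstrainedSystem (n m k : ℕ) where
  /-- inertia matrix -/
  M : Vec n → Matrix (Fin n) (Fin n) ℝ
  /-- matrix `C(q, q̇)` of the Coriolis and centrifugal terms -/
  C : Vec n → Vec n → Matrix (Fin n) (Fin n) ℝ
  /-- constraint matrix -/
  A : Vec n → Matrix (Fin m) (Fin n) ℝ
  /-- actuation matrix -/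
  B : Vec n → Matrix (Fin n) (Fin k) ℝ
  /-- gravitational generalized force -/
  fg : Vec n → Vec n
  M_contDiff : ∀ i j, ContDiff ℝ 1 (fun q => M q i j)
  M_posDef : ∀ q, (M q).PosDef
  /-- `Ṁ - 2 C` is skew-symmetric: the usual convention for factoring the Coriolis and centrifugal
  forces as `C(q, q̇) q̇` (satisfied, for instance, by the Christoffel symbols of `M`) -/
  skew : ∀ q v, (matDeriv M q v - (2 : ℝ) • C q v).transpose =
    -(matDeriv M q v - (2 : ℝ) • C q v)

namespace ConstrainedSystem

variable {n m k : ℕ} (S : ConstrainedSystem n m k)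

/-- The condition `R(PB) = N(A)` or `N(A) ⊆ R(B)` at the configuration `q`. -/
def ActuationCondition (q : Vec n) : Prop :=
  rangeSpace (nullProj (S.A q) * S.B q) = nullSpace (S.A q) ∨
    nullSpace (S.A q) ≤ rangeSpace (S.B q)

/-- `q : [0, ∞) → ℝⁿ`, with velocity `v = q̇`, is a motion of the constrained system
`M q̈ + C q̇ = f_g + f_c + f`, `A q̇ = 0`, under the state feedback `f = f(q, q̇)`.
The constraint force `f_c` does no work on admissible velocities, that is, it is orthogonal to the
null space of `A`. The feedback may be discontinuous, so motions are understood in the sense of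
Carathéodory: the velocity is locally absolutely continuous and the equation of motion holds for
almost every time. -/
structure IsMotion (f : Vec n → Vec n → Vec n) (q v : ℝ → Vec n) : Prop where
  velocity : ∀ t, 0 ≤ t → HasDerivWithinAt q (v t) (Set.Ici 0) t
  absCont : ∀ T, 0 < T → AbsolutelyContinuousOnInterval v 0 T
  constraint : ∀ t, 0 ≤ t → act (S.A (q t)) (v t) = 0
  dynamics : ∀ᵐ t ∂(volume.restrict (Set.Ici (0 : ℝ))), ∃ a fc : Vec n,
    HasDerivAt v a t ∧ fc ∈ (nullSpace (S.A (q t)))ᗮ ∧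
      act (S.M (q t)) a + act (S.C (q t) (v t)) (v t) = S.fg (q t) + fc + f (q t) (v t)

/-- The unit vector `η` in the direction of the velocity; at rest it is the chosen vector `ξ`. -/
def unitDir (ξ : Vec n → Vec n) (q v : Vec n) : Vec n :=
  open Classical in if v ≠ 0 then ‖v‖⁻¹ • v else ξ q

/-- The control law `f = -R(q) (f_g(q) + K_p (e + σ ‖e‖ η) + K_d q̇)`, where `e = q - q*`. -/
def controlLaw (ξ : Vec n → Vec n) (Kp Kd σ : ℝ) (qd : Vec n) (q v : Vec n) : Vec n :=
  -act (obliqueProj (S.A q) (S.B q))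
    (S.fg q + Kp • ((q - qd) + (σ * ‖q - qd‖) • unitDir ξ q v) + Kd • v)

end ConstrainedSystem

end ConstrainedControl

end

/-! Write `T` for the kinetic energy. Admissible velocities are orthogonal to `f_c`, and `P R = P`,
so along a motion only `f_g` cancelled by the feedback matters: `T' = -Kp (v·e + σ‖e‖‖v‖) - Kd‖v‖²`.
Hence `T + Kp‖e‖²/2` decreases, which confines `q` to a ball where `T` is comparable to `‖v‖²`. By
Cauchy–Schwarz, `T' ≤ -Kp (σ - 1)‖e‖‖v‖ - Kd‖v‖²`; the damping term alone forces `T → 0`, so `v →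
0`.

Both energies converge, so `‖e‖` has a limit. If it were positive, the term in `‖e‖‖v‖` would act as
dry friction, `T' ≤ -δ√T`, and the system would stop in finite time and stay at rest. The projected
equation of motion at rest reads `P e = -σ‖e‖ξ`, and `‖P e‖ ≤ ‖e‖` with `σ > 1` leaves only `e = 0`.
This direct argument needs no invariance principle, which the discontinuous feedback would
complicate. -/

/-! ### Absolutely continuous functions and differential inequalities -/

/-- A Lipschitz function of an absolutely continuous function is absolutely continuous. -/
theorem LipschitzOnWith.comp_absolutelyContinuousOnInterval {X Y : Type*} [PseudoMetricSpace X]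
    [PseudoMetricSpace Y] {f : ℝ → X} {g : X → Y} {a b : ℝ} {K : NNReal} {s : Set X}
    (hg : LipschitzOnWith K g s) (hf : AbsolutelyContinuousOnInterval f a b)
    (hfs : Set.MapsTo f (Set.uIcc a b) s) :
    AbsolutelyContinuousOnInterval (fun t => g (f t)) a b := by
  rw [absolutelyContinuousOnInterval_iff] at hf ⊢
  intro ε hε
  obtain ⟨δ, hδ, h⟩ := hf (ε / (K + 1)) (by positivity)
  refine ⟨δ, hδ, fun E hE hE' => ?_⟩
  calc ∑ i ∈ Finset.range E.1, dist (g (f (E.2 i).1)) (g (f (E.2 i).2))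
      ≤ ∑ i ∈ Finset.range E.1, (K + 1 : ℝ) * dist (f (E.2 i).1) (f (E.2 i).2) := by
        refine Finset.sum_le_sum fun i hi => ?_
        refine (hg.dist_le_mul _ (hfs (hE.1 i hi).1) _ (hfs (hE.1 i hi).2)).trans ?_
        gcongr
        linarith
    _ = (K + 1 : ℝ) * ∑ i ∈ Finset.range E.1, dist (f (E.2 i).1) (f (E.2 i).2) := by
        rw [Finset.mul_sum]
    _ < (K + 1 : ℝ) * (ε / (K + 1)) := by
        gcongr
        exact h E hE hE'
    _ = ε := by field_simp

theorem AbsolutelyContinuousOnInterval.fun_sum {ι F : Type*} [NormedAddCommGroup F]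
    {f : ι → ℝ → F} {a b : ℝ} (s : Finset ι)
    (hf : ∀ i ∈ s, AbsolutelyContinuousOnInterval (f i) a b) :
    AbsolutelyContinuousOnInterval (fun t => ∑ i ∈ s, f i t) a b := by
  classical
  induction s using Finset.induction_on with
  | empty =>
    simp only [Finset.sum_empty]
    exact ((LipschitzWith.const (0 : F)).lipschitzOnWith
      (s := Set.uIcc a b)).absolutelyContinuousOnInterval
  | insert i s hi ih =>
    simp only [Finset.sum_insert hi]
    exact (hf i (Finset.mem_insert_self i s)).fun_add
      (ih fun j hj => hf j (Finset.mem_insert_of_mem hj))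

/-- An upper bound on the almost everywhere derivative of an absolutely continuous function bounds
its increments. -/
theorem AbsolutelyContinuousOnInterval.sub_le_of_ae_hasDerivAt_le {f : ℝ → ℝ} {a b c : ℝ}
    (hab : a ≤ b) (hf : AbsolutelyContinuousOnInterval f a b)
    (hd : ∀ᵐ t, t ∈ Set.Ioo a b → ∃ d, HasDerivAt f d t ∧ d ≤ c) :
    f b - f a ≤ c * (b - a) := by
  rw [← hf.integral_deriv_eq_sub]
  have hle : (∫ t in a..b, deriv f t) ≤ ∫ _t in a..b, c := by
    refine intervalIntegral.integral_mono_ae_restrict hab hf.intervalIntegrable_deriv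
      intervalIntegrable_const ?_
    rw [Measure.restrict_congr_set Ioo_ae_eq_Icc.symm, EventuallyLE,
      ae_restrict_iff' measurableSet_Ioo]
    filter_upwards [hd] with t ht hmem
    obtain ⟨d, h1, h2⟩ := ht hmem
    rwa [h1.deriv]
  refine hle.trans (le_of_eq ?_)
  rw [intervalIntegral.integral_const, smul_eq_mul, mul_comm]

/-- A nonnegative function whose derivative is bounded above by a negative multiple of its square
root vanishes in finite time. -/
theorem exists_eq_zero_of_deriv_le_neg_sqrt {f : ℝ → ℝ} {t₀ δ : ℝ} (hδ : 0 < δ)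
    (hnn : ∀ t, t₀ ≤ t → 0 ≤ f t)
    (hac : ∀ b, t₀ ≤ b → AbsolutelyContinuousOnInterval f t₀ b)
    (hd : ∀ᵐ t, t₀ < t → ∃ d, HasDerivAt f d t ∧ d ≤ -δ * √(f t)) :
    ∃ t, t₀ ≤ t ∧ f t = 0 := by
  by_contra! hne
  have hpos : ∀ t, t₀ ≤ t → 0 < f t := fun t ht => (hnn t ht).lt_of_ne' (hne t ht)
  have key : ∀ b, t₀ ≤ b → √(f b) - √(f t₀) ≤ (-(δ / 2)) * (b - t₀) := by
    intro b hb
    -- The square root is not Lipschitz at zero, but `f` has a positive minimum on `[t₀, b]`, so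
    -- `√f` is still absolutely continuous there.
    obtain ⟨s, hs, hmin⟩ := isCompact_Icc.exists_isMinOn
      (Set.nonempty_Icc.mpr hb) (Set.uIcc_of_le hb ▸ (hac b hb).continuousOn)
    have hm := hpos s hs.1
    obtain ⟨d, hd1⟩ := (hac b hb).exists_bound
    have hlip : ∃ K, LipschitzOnWith K Real.sqrt (Set.Icc (f s) d) := by
      refine ContDiffOn.exists_lipschitzOnWith (n := 1) ?_ (by simp) (convex_Icc _ _) isCompact_Icc
      intro x hx
      exact (Real.contDiffAt_sqrt (hm.trans_le hx.1).ne').contDiffWithinAt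
    obtain ⟨K, hK⟩ := hlip
    refine AbsolutelyContinuousOnInterval.sub_le_of_ae_hasDerivAt_le hb
      (hK.comp_absolutelyContinuousOnInterval (hac b hb) ?_) ?_
    · intro t ht
      refine ⟨hmin (Set.uIcc_of_le hb ▸ ht), (le_abs_self _).trans (hd1 t ht)⟩
    · filter_upwards [hd] with t ht hmem
      obtain ⟨d, h1, h2⟩ := ht hmem.1
      have hp := hpos t hmem.1.le
      refine ⟨_, h1.sqrt hp.ne', ?_⟩
      have hsq := Real.sqrt_pos.mpr hp
      rw [div_le_iff₀ (by positivity)]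
      linarith
  have h0 := Real.sqrt_nonneg (f t₀)
  -- By this time the bound has fallen by `√(f t₀) + 1`, which would make `√f` negative.
  have := key (t₀ + 2 * (√(f t₀) + 1) / δ) (by have : 0 ≤ 2 * (√(f t₀) + 1) / δ := by positivity
                                               linarith)
  have h1 := Real.sqrt_nonneg (f (t₀ + 2 * (√(f t₀) + 1) / δ))
  have h2 : (-(δ / 2)) * (t₀ + 2 * (√(f t₀) + 1) / δ - t₀) = -(√(f t₀) + 1) := by
    field_simp
    ring
  linarith

/-- A nonnegative function that decays at least at a rate proportional to its value tends to zero. -/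
theorem tendsto_zero_of_deriv_le_neg_mul {f : ℝ → ℝ} {δ : ℝ} (hδ : 0 < δ)
    (hnn : ∀ t, 0 ≤ t → 0 ≤ f t)
    (hanti : AntitoneOn f (Set.Ici 0))
    (hac : ∀ b, 0 ≤ b → AbsolutelyContinuousOnInterval f 0 b)
    (hd : ∀ᵐ t, 0 < t → ∃ d, HasDerivAt f d t ∧ d ≤ -δ * f t) :
    Tendsto f atTop (𝓝 0) := by
  have hsmall : ∀ ε > 0, ∃ t, 0 ≤ t ∧ f t < ε := by
    intro ε hε
    by_contra! hge
    have h0 := hnn 0 le_rfl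
    -- If `f ≥ ε` throughout, `f` loses at least `f 0 + 1` by time `b`.
    set b := (f 0 + 1) / (δ * ε) with hb
    have hb0 : 0 ≤ b := by positivity
    have := (hac b hb0).sub_le_of_ae_hasDerivAt_le (c := -(δ * ε)) hb0 (by
      filter_upwards [hd] with t ht hmem
      obtain ⟨d, h1, h2⟩ := ht hmem.1
      refine ⟨d, h1, h2.trans ?_⟩
      have := mul_le_mul_of_nonneg_left (hge t hmem.1.le) hδ.le
      linarith)
    have h2 : -(δ * ε) * (b - 0) = -(f 0 + 1) := by
      rw [hb]
      field_simp
      ring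
    linarith [hnn b hb0]
  rw [Metric.tendsto_atTop]
  intro ε hε
  obtain ⟨t, ht, hlt⟩ := hsmall ε hε
  refine ⟨t, fun s hs => ?_⟩
  have hs0 : 0 ≤ s := ht.trans hs
  rw [Real.dist_eq, sub_zero, abs_of_nonneg (hnn s hs0)]
  exact (hanti ht hs0 hs).trans_lt hlt

/-- A nonnegative function that is antitone on `[0, ∞)` converges. -/
theorem exists_tendsto_of_antitoneOn_of_nonneg {f : ℝ → ℝ} (hnn : ∀ t, 0 ≤ t → 0 ≤ f t)
    (hanti : AntitoneOn f (Set.Ici 0)) : ∃ l, Tendsto f atTop (𝓝 l) := by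
  have hm : Antitone fun t => f (max t 0) := fun s t hst =>
    hanti (Set.mem_Ici.mpr (le_max_right _ _)) (Set.mem_Ici.mpr (le_max_right _ _)) (max_le_max_right 0 hst)
  refine ⟨_, (tendsto_atTop_ciInf hm ⟨0, ?_⟩).congr' ?_⟩
  · rintro _ ⟨t, rfl⟩
    exact hnn _ (le_max_right _ _)
  · filter_upwards [eventually_ge_atTop 0] with t ht
    rw [max_eq_left ht]

/-! ### Projections and quadratic forms -/

namespace ConstrainedControl

theorem act_nullProj {m n : ℕ} (A : Matrix (Fin m) (Fin n) ℝ) (x : Vec n) :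
    act (nullProj A) x = (nullSpace A).starProjection x := by
  rw [act, nullProj, LinearEquiv.apply_symm_apply]
  rfl

/-- The projection fixes the null space, so the second alternative of the actuation condition
implies the first. -/
theorem rangeSpace_nullProj_mul {m n k : ℕ} (A : Matrix (Fin m) (Fin n) ℝ)
    (B : Matrix (Fin n) (Fin k) ℝ) (h : nullSpace A ≤ rangeSpace B) :
    rangeSpace (nullProj A * B) = nullSpace A := by
  apply le_antisymm
  · rintro _ ⟨x, rfl⟩
    rw [Matrix.toLpLin_mul (q := 2), LinearMap.comp_apply]
    have := Submodule.starProjection_apply_mem (nullSpace A) (act B x)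
    rwa [← act_nullProj] at this
  · intro x hx
    obtain ⟨y, rfl⟩ := h hx
    refine ⟨y, ?_⟩
    rw [Matrix.toLpLin_mul (q := 2), LinearMap.comp_apply]
    exact (act_nullProj A _).trans (Submodule.starProjection_eq_self_iff.mpr hx)

/-- Projecting onto the null space of the constraints undoes the oblique projection. -/
theorem starProjection_obliqueProj {m n k : ℕ} (A : Matrix (Fin m) (Fin n) ℝ)
    (B : Matrix (Fin n) (Fin k) ℝ) (h : rangeSpace (nullProj A * B) = nullSpace A) (x : Vec n) :
    (nullSpace A).starProjection (act (obliqueProj A B) x) = (nullSpace A).starProjection x := by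
  rw [← act_nullProj, act, act, ← LinearMap.comp_apply, ← Matrix.toLpLin_mul (q := 2), obliqueProj,
    ← Matrix.mul_assoc, toEuclideanLin_mul_pinv]
  change (rangeSpace (nullProj A * B)).starProjection x = _
  congr 2

/-- The orthogonal projection is symmetric and fixes `v`, so it can be inserted in front of the
oblique one. -/
theorem inner_obliqueProj {m n k : ℕ} (A : Matrix (Fin m) (Fin n) ℝ)
    (B : Matrix (Fin n) (Fin k) ℝ) (h : rangeSpace (nullProj A * B) = nullSpace A)
    {v : Vec n} (hv : v ∈ nullSpace A) (x : Vec n) :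
    inner ℝ v (act (obliqueProj A B) x) = inner ℝ v x := by
  conv_lhs => rw [← Submodule.starProjection_eq_self_iff.mpr hv]
  rw [Submodule.inner_starProjection_left_eq_right, starProjection_obliqueProj A B h,
    ← Submodule.inner_starProjection_left_eq_right, Submodule.starProjection_eq_self_iff.mpr hv]

theorem inner_act_eq_sum {n : ℕ} (X : Matrix (Fin n) (Fin n) ℝ) (x y : Vec n) :
    inner ℝ x (act X y) = ∑ i, ∑ j, x i * (X i j * y j) := by
  simp only [← Finset.mul_sum, EuclideanSpace.inner_eq_star_dotProduct, dotProduct_comm _ (star _)]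
  rfl

theorem inner_act_comm {n : ℕ} {X : Matrix (Fin n) (Fin n) ℝ} (hX : X.transpose = X)
    (x y : Vec n) : inner ℝ x (act X y) = inner ℝ y (act X x) := by
  rw [inner_act_eq_sum, inner_act_eq_sum, Finset.sum_comm]
  refine Finset.sum_congr rfl fun i _ => Finset.sum_congr rfl fun j _ => ?_
  rw [← congrFun (congrFun hX j) i, Matrix.transpose_apply]
  ring

theorem inner_act_self_of_skew {n : ℕ} {X : Matrix (Fin n) (Fin n) ℝ} (hX : X.transpose = -X)
    (x : Vec n) : inner ℝ x (act X x) = 0 := by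
  have h : inner ℝ x (act X x) = -inner ℝ x (act X x) := by
    conv_lhs => rw [inner_act_eq_sum, Finset.sum_comm]
    rw [inner_act_eq_sum, ← Finset.sum_neg_distrib]
    refine Finset.sum_congr rfl fun i _ => ?_
    rw [← Finset.sum_neg_distrib]
    refine Finset.sum_congr rfl fun j _ => ?_
    have : X j i = -X i j := congrFun (congrFun hX i) j
    rw [this]
    ring
  linarith

theorem inner_act_pos {n : ℕ} {X : Matrix (Fin n) (Fin n) ℝ} (hX : X.PosDef) {x : Vec n}
    (hx : x ≠ 0) : 0 < inner ℝ x (act X x) := by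
  have h := (Matrix.posDef_iff_dotProduct_mulVec.mp hX).2 (x := x.ofLp)
    (by simpa using hx)
  rw [EuclideanSpace.inner_eq_star_dotProduct, dotProduct_comm]
  exact h

/-! ### Kinetic energy -/

namespace ConstrainedSystem

variable {n m k : ℕ} (S : ConstrainedSystem n m k)

theorem rangeSpace_eq_of_actuationCondition {q : Vec n} (h : S.ActuationCondition q) :
    rangeSpace (nullProj (S.A q) * S.B q) = nullSpace (S.A q) :=
  h.elim id (rangeSpace_nullProj_mul _ _)

theorem M_transpose (q : Vec n) : (S.M q).transpose = S.M q := by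
  rw [← Matrix.conjTranspose_eq_transpose_of_trivial]
  exact (S.M_posDef q).isHermitian

theorem inner_matDeriv (q v : Vec n) :
    inner ℝ v (act (matDeriv S.M q v) v) = 2 * inner ℝ v (act (S.C q v) v) := by
  have h := inner_act_self_of_skew (S.skew q v) v
  rw [act, map_sub, LinearMap.sub_apply, map_smul, LinearMap.smul_apply, inner_sub_right,
    real_inner_smul_right] at h
  exact sub_eq_zero.mp h

/-- The kinetic energy. -/
noncomputable def kinetic (q v : Vec n) : ℝ := inner ℝ v (act (S.M q) v) / 2

theorem kinetic_nonneg (q v : Vec n) : 0 ≤ S.kinetic q v := by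
  rcases eq_or_ne v 0 with rfl | hv
  · simp [kinetic]
  · exact (half_pos (inner_act_pos (S.M_posDef q) hv)).le

theorem continuous_inner_act_M :
    Continuous fun p : Vec n × Vec n => inner ℝ p.2 (act (S.M p.1) p.2) := by
  simp only [inner_act_eq_sum]
  have hM : ∀ i j, Continuous fun p : Vec n × Vec n => S.M p.1 i j := fun i j =>
    (S.M_contDiff i j).continuous.comp continuous_fst
  have := hM
  fun_prop

/-- On a compact set of configurations the kinetic energy is comparable to `‖v‖²`. -/
theorem exists_kinetic_bounds {K : Set (Vec n)} (hK : IsCompact K) :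
    ∃ μ L : ℝ, 0 < μ ∧ 0 < L ∧ ∀ q ∈ K, ∀ v, μ * ‖v‖ ^ 2 ≤ S.kinetic q v ∧
      S.kinetic q v ≤ L * ‖v‖ ^ 2 := by
  have hc : IsCompact (K ×ˢ Metric.sphere (0 : Vec n) 1) := hK.prod (isCompact_sphere 0 1)
  obtain ⟨μ, hμ, hlow⟩ := hc.exists_forall_le' S.continuous_inner_act_M.continuousOn (a := 0)
    fun p hp => inner_act_pos (S.M_posDef p.1) (by
      intro h
      simpa [h] using hp.2)
  obtain ⟨L, hup⟩ := hc.exists_bound_of_continuousOn S.continuous_inner_act_M.continuousOn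
  -- The maximum keeps the upper constant positive even when the compact set is empty.
  refine ⟨μ / 2, max L 1 / 2, by positivity, by positivity, fun q hq v => ?_⟩
  rcases eq_or_ne v 0 with rfl | hv
  · simp [kinetic]
  have hv' : 0 < ‖v‖ := norm_pos_iff.mpr hv
  have hmem : (q, ‖v‖⁻¹ • v) ∈ K ×ˢ Metric.sphere (0 : Vec n) 1 := by
    refine ⟨hq, ?_⟩
    rw [mem_sphere_zero_iff_norm, norm_smul, norm_inv, norm_norm, inv_mul_cancel₀ hv'.ne']
  have hscale : inner ℝ v (act (S.M q) v) =
      ‖v‖ ^ 2 * inner ℝ (‖v‖⁻¹ • v) (act (S.M q) (‖v‖⁻¹ • v)) := by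
    rw [act, act, map_smul, real_inner_smul_left, real_inner_smul_right]
    field_simp
  have h1 := hlow _ hmem
  have h2 := (le_abs_self _).trans ((hup _ hmem).trans (le_max_left L 1))
  simp only at h1 h2
  have hsq : 0 ≤ ‖v‖ ^ 2 := by positivity
  rw [kinetic, hscale]
  constructor
  · nlinarith [mul_le_mul_of_nonneg_left h1 hsq]
  · nlinarith [mul_le_mul_of_nonneg_left h2 hsq]

theorem absolutelyContinuousOnInterval_kinetic {q v : ℝ → Vec n} {b : ℝ}
    (hq : ContDiffOn ℝ 1 q (Set.uIcc 0 b)) (hv : AbsolutelyContinuousOnInterval v 0 b) :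
    AbsolutelyContinuousOnInterval (fun t => S.kinetic (q t) (v t)) 0 b := by
  simp only [kinetic, inner_act_eq_sum, div_eq_inv_mul]
  have hvi : ∀ i, AbsolutelyContinuousOnInterval (fun t => v t i) 0 b := fun i =>
    ((EuclideanSpace.proj i : Vec n →L[ℝ] ℝ).lipschitz.lipschitzOnWith
      (s := Set.univ)).comp_absolutelyContinuousOnInterval hv (Set.mapsTo_univ _ _)
  refine AbsolutelyContinuousOnInterval.const_mul _ ?_
  refine AbsolutelyContinuousOnInterval.fun_sum _ fun i _ => ?_
  refine AbsolutelyContinuousOnInterval.fun_sum _ fun j _ => ?_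
  refine (hvi i).fun_mul (AbsolutelyContinuousOnInterval.fun_mul ?_ (hvi j))
  exact ((S.M_contDiff i j).comp_contDiffOn hq).absolutelyContinuousOnInterval

/-- The product rule leaves half the power of `Ṁ`, which skew-symmetry trades for that of `C`; the
left side of the equation of motion then appears as a whole. -/
theorem hasDerivAt_kinetic {q v : ℝ → Vec n} {t : ℝ} {a : Vec n}
    (hq : HasDerivAt q (v t) t) (hv : HasDerivAt v a t) :
    HasDerivAt (fun s => S.kinetic (q s) (v s))
      (inner ℝ (v t) (act (S.M (q t)) a + act (S.C (q t) (v t)) (v t))) t := by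
  have hvi : ∀ i, HasDerivAt (fun s => v s i) (a i) t := fun i =>
    (EuclideanSpace.proj i : Vec n →L[ℝ] ℝ).hasFDerivAt.comp_hasDerivAt t hv
  have hMij : ∀ i j, HasDerivAt (fun s => S.M (q s) i j) (matDeriv S.M (q t) (v t) i j) t :=
    fun i j => (((S.M_contDiff i j).differentiable (by simp)) (q t)).hasFDerivAt.comp_hasDerivAt t hq
  have h := (HasDerivAt.fun_sum (u := Finset.univ) fun i _ =>
    HasDerivAt.fun_sum (u := Finset.univ) fun j _ =>
      (hvi i).fun_mul ((hMij i j).fun_mul (hvi j))).div_const 2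
  refine HasDerivAt.congr_deriv (by simpa only [kinetic, inner_act_eq_sum] using h) ?_
  have e : ∑ i, ∑ j, (a i * (S.M (q t) i j * v t j) +
      v t i * (matDeriv S.M (q t) (v t) i j * v t j + S.M (q t) i j * a j)) =
      inner ℝ a (act (S.M (q t)) (v t)) + (inner ℝ (v t) (act (matDeriv S.M (q t) (v t)) (v t)) +
        inner ℝ (v t) (act (S.M (q t)) a)) := by
    simp only [inner_act_eq_sum, ← Finset.sum_add_distrib, mul_add]
  rw [e, inner_matDeriv, inner_act_comm (S.M_transpose (q t)) a, inner_add_right]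
  ring

end ConstrainedSystem

end ConstrainedControl

/-! ### Power and equilibria of the closed loop -/

namespace ConstrainedControl

namespace ConstrainedSystem

variable {n m k : ℕ} (S : ConstrainedSystem n m k)

theorem inner_unitDir (ξ : Vec n → Vec n) (q v : Vec n) : inner ℝ v (unitDir ξ q v) = ‖v‖ := by
  unfold unitDir
  split_ifs with h
  · rw [real_inner_smul_right, real_inner_self_eq_norm_sq]
    have := norm_ne_zero_iff.mpr h
    field_simp
  · rw [not_not.mp h, inner_zero_left, norm_zero]

/-- The power of the closed-loop forces along admissible velocities. -/
theorem inner_closedLoop {ξ : Vec n → Vec n} {Kp Kd σ : ℝ} {qd q v fc : Vec n}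
    (hB : S.ActuationCondition q) (hv : v ∈ nullSpace (S.A q)) (hfc : fc ∈ (nullSpace (S.A q))ᗮ) :
    inner ℝ v (S.fg q + fc + S.controlLaw ξ Kp Kd σ qd q v) =
      -(Kp * (inner ℝ v (q - qd) + σ * ‖q - qd‖ * ‖v‖)) - Kd * ‖v‖ ^ 2 := by
  rw [controlLaw, inner_add_right, inner_add_right, inner_neg_right,
    inner_obliqueProj _ _ (S.rangeSpace_eq_of_actuationCondition hB) hv,
    (Submodule.mem_orthogonal _ _).mp hfc v hv]
  simp only [inner_add_right, real_inner_smul_right, inner_unitDir, real_inner_self_eq_norm_sq]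
  ring

/-- With `σ > 1` the closed loop is in equilibrium only at the target. -/
theorem eq_target_of_equilibrium {ξ : Vec n → Vec n} {Kp Kd σ : ℝ} {qd q fc : Vec n}
    (hB : S.ActuationCondition q) (hξ : ‖ξ q‖ = 1 ∧ ξ q ∈ nullSpace (S.A q))
    (hKp : 0 < Kp) (hσ : 1 < σ) (hfc : fc ∈ (nullSpace (S.A q))ᗮ)
    (h : S.fg q + fc + S.controlLaw ξ Kp Kd σ qd q 0 = 0) : q = qd := by
  -- Projecting kills `fc` and turns the oblique projection into the orthogonal one, so `fg`
  -- cancels.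
  have hP := congrArg (nullSpace (S.A q)).starProjection h
  have hu : unitDir ξ q 0 = ξ q := by simp [unitDir]
  rw [controlLaw, map_add, map_add, map_neg,
    starProjection_obliqueProj _ _ (S.rangeSpace_eq_of_actuationCondition hB),
    (Submodule.starProjection_apply_eq_zero_iff (K := nullSpace (S.A q))).mpr hfc, hu] at hP
  simp only [map_add, map_smul, map_zero, smul_zero, add_zero,
    Submodule.starProjection_eq_self_iff.mpr hξ.2] at hP
  have h0 : Kp • ((nullSpace (S.A q)).starProjection (q - qd) + (σ * ‖q - qd‖) • ξ q) = 0 := by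
    rwa [neg_add, add_neg_cancel_left, neg_eq_zero] at hP
  have h1 := (smul_eq_zero.mp h0).resolve_left hKp.ne'
  have h2 : ‖(nullSpace (S.A q)).starProjection (q - qd)‖ = σ * ‖q - qd‖ := by
    rw [eq_neg_of_add_eq_zero_left h1, norm_neg, norm_smul, hξ.1, mul_one, Real.norm_eq_abs,
      abs_of_nonneg (by positivity)]
  have h3 := (nullSpace (S.A q)).norm_starProjection_apply_le (q - qd)
  by_contra hne
  have h4 : 0 < ‖q - qd‖ := norm_pos_iff.mpr (sub_ne_zero.mpr hne)
  nlinarith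

/-! ### Motions of the closed loop -/

namespace IsMotion

variable {S} {f : Vec n → Vec n → Vec n} {q v : ℝ → Vec n}

theorem contDiffOn (h : S.IsMotion f q v) {b : ℝ} (hb : 0 < b) :
    ContDiffOn ℝ 1 q (Set.Icc 0 b) := by
  have hd : ∀ t ∈ Set.Icc 0 b, HasDerivWithinAt q (v t) (Set.Icc 0 b) t := fun t ht =>
    (h.velocity t ht.1).mono Set.Icc_subset_Ici_self
  have hu := uniqueDiffOn_Icc hb
  rw [show (1 : WithTop ℕ∞) = 0 + 1 by simp, contDiffOn_succ_iff_derivWithin hu]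
  refine ⟨fun t ht => (hd t ht).differentiableWithinAt, by simp, ?_⟩
  rw [contDiffOn_zero]
  have hc := (h.absCont b hb).continuousOn
  rw [Set.uIcc_of_le hb.le] at hc
  exact hc.congr fun t ht => (hd t ht).derivWithin (hu t ht)

theorem absolutelyContinuousOnInterval_kinetic (h : S.IsMotion f q v) {a b : ℝ} (ha : 0 ≤ a)
    (hab : a ≤ b) : AbsolutelyContinuousOnInterval (fun t => S.kinetic (q t) (v t)) a b := by
  -- Enlarging the interval covers the degenerate case `a = b = 0`.
  have hb : 0 < b + 1 := by linarith
  refine (S.absolutelyContinuousOnInterval_kinetic (b := b + 1)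
    ((Set.uIcc_of_le hb.le).symm ▸ h.contDiffOn hb) (h.absCont _ hb)).mono ?_
  rw [Set.uIcc_of_le hab, Set.uIcc_of_le hb.le]
  exact Set.Icc_subset_Icc ha (by linarith)

theorem absolutelyContinuousOnInterval_normSq (h : S.IsMotion f q v) (qd : Vec n) {a b : ℝ}
    (ha : 0 ≤ a) (hab : a ≤ b) :
    AbsolutelyContinuousOnInterval (fun t => ‖q t - qd‖ ^ 2) a b := by
  have hb : 0 < b + 1 := by linarith
  have hc : ContDiffOn ℝ 1 (fun t => ‖q t - qd‖ ^ 2) (Set.Icc 0 (b + 1)) :=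
    ((h.contDiffOn hb).sub contDiffOn_const).norm_sq ℝ
  refine ContDiffOn.absolutelyContinuousOnInterval (hc.mono ?_)
  rw [Set.uIcc_of_le hab]
  exact Set.Icc_subset_Icc ha (by linarith)

theorem hasDerivAt_config (h : S.IsMotion f q v) {t : ℝ} (ht : 0 < t) : HasDerivAt q (v t) t :=
  (h.velocity t ht.le).hasDerivAt (Ici_mem_nhds ht)

variable {ξ : Vec n → Vec n} {Kp Kd σ : ℝ} {qd : Vec n}

/-- The power balance of the closed loop. -/
theorem ae_hasDerivAt_kinetic (h : S.IsMotion (S.controlLaw ξ Kp Kd σ qd) q v)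
    (hB : ∀ q, S.ActuationCondition q) :
    ∀ᵐ t, 0 < t → HasDerivAt (fun s => S.kinetic (q s) (v s))
      (-(Kp * (inner ℝ (v t) (q t - qd) + σ * ‖q t - qd‖ * ‖v t‖)) - Kd * ‖v t‖ ^ 2) t := by
  have hdyn := (ae_restrict_iff' measurableSet_Ici).mp h.dynamics
  filter_upwards [hdyn] with t ht hpos
  obtain ⟨a, fc, ha, hfc, heq⟩ := ht hpos.le
  have hk := S.hasDerivAt_kinetic (h.hasDerivAt_config hpos) ha
  rwa [heq, S.inner_closedLoop (hB _) (h.constraint t hpos.le) hfc] at hk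

theorem ae_exists_deriv_kinetic_le (h : S.IsMotion (S.controlLaw ξ Kp Kd σ qd) q v)
    (hB : ∀ q, S.ActuationCondition q) (hKp : 0 < Kp) :
    ∀ᵐ t, 0 < t → ∃ d, HasDerivAt (fun s => S.kinetic (q s) (v s)) d t ∧
      d ≤ -(Kp * (σ - 1)) * (‖q t - qd‖ * ‖v t‖) - Kd * ‖v t‖ ^ 2 := by
  filter_upwards [h.ae_hasDerivAt_kinetic hB] with t ht hpos
  refine ⟨_, ht hpos, ?_⟩
  have hcs := neg_le_of_abs_le (abs_real_inner_le_norm (v t) (q t - qd))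
  nlinarith [mul_le_mul_of_nonneg_left hcs hKp.le]

theorem antitoneOn_kinetic (h : S.IsMotion (S.controlLaw ξ Kp Kd σ qd) q v)
    (hB : ∀ q, S.ActuationCondition q) (hKp : 0 < Kp) (hKd : 0 < Kd) (hσ : 1 < σ) :
    AntitoneOn (fun t => S.kinetic (q t) (v t)) (Set.Ici 0) := by
  intro a ha b _ hab
  have := (h.absolutelyContinuousOnInterval_kinetic ha hab).sub_le_of_ae_hasDerivAt_le (c := 0) hab
    (by
      filter_upwards [h.ae_exists_deriv_kinetic_le hB hKp] with t ht hmem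
      obtain ⟨d, h1, h2⟩ := ht (lt_of_le_of_lt ha hmem.1)
      refine ⟨d, h1, h2.trans ?_⟩
      have h3 : 0 ≤ Kp * (σ - 1) * (‖q t - qd‖ * ‖v t‖) :=
        mul_nonneg (mul_nonneg hKp.le (by linarith)) (by positivity)
      have h4 : 0 ≤ Kd * ‖v t‖ ^ 2 := by positivity
      linarith)
  simp only
  linarith

/-- The energy with the artificial potential `Kp ‖e‖² / 2` decreases along the closed loop. -/
theorem antitoneOn_energy (h : S.IsMotion (S.controlLaw ξ Kp Kd σ qd) q v)
    (hB : ∀ q, S.ActuationCondition q) (hKp : 0 < Kp) (hKd : 0 < Kd) (hσ : 1 < σ) :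
    AntitoneOn (fun t => S.kinetic (q t) (v t) + Kp / 2 * ‖q t - qd‖ ^ 2) (Set.Ici 0) := by
  intro a ha b _ hab
  have := ((h.absolutelyContinuousOnInterval_kinetic ha hab).fun_add
    ((h.absolutelyContinuousOnInterval_normSq qd ha hab).const_mul
      (Kp / 2))).sub_le_of_ae_hasDerivAt_le (c := 0) hab (by
      filter_upwards [h.ae_hasDerivAt_kinetic hB] with t ht hmem
      have hpos : 0 < t := lt_of_le_of_lt ha hmem.1
      refine ⟨_, (ht hpos).fun_add
        ((((h.hasDerivAt_config hpos).sub_const qd).norm_sq).const_mul (Kp / 2)), ?_⟩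
      -- The potential contributes `Kp (v·e)`, which cancels the sign-indefinite term of the power.
      rw [real_inner_comm]
      have h3 : 0 ≤ Kp * (σ * ‖q t - qd‖ * ‖v t‖) := by positivity
      have h4 : 0 ≤ Kd * ‖v t‖ ^ 2 := by positivity
      linarith)
  simp only
  linarith

/-- The decreasing energy gives `‖e‖² ≤ 2E/Kp`, so the configuration stays in a compact ball. -/
theorem exists_kinetic_bounds (h : S.IsMotion (S.controlLaw ξ Kp Kd σ qd) q v)
    (hB : ∀ q, S.ActuationCondition q) (hKp : 0 < Kp) (hKd : 0 < Kd) (hσ : 1 < σ) :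
    ∃ μ L : ℝ, 0 < μ ∧ 0 < L ∧ ∀ t, 0 ≤ t →
      μ * ‖v t‖ ^ 2 ≤ S.kinetic (q t) (v t) ∧ S.kinetic (q t) (v t) ≤ L * ‖v t‖ ^ 2 := by
  set E := S.kinetic (q 0) (v 0) + Kp / 2 * ‖q 0 - qd‖ ^ 2 with hE
  obtain ⟨μ, L, hμ, hL, hb⟩ :=
    S.exists_kinetic_bounds (isCompact_closedBall qd √(2 * E / Kp))
  refine ⟨μ, L, hμ, hL, fun t ht => hb _ ?_ _⟩
  rw [mem_closedBall_iff_norm]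
  apply Real.le_sqrt_of_sq_le
  rw [le_div_iff₀ hKp]
  have h1 := h.antitoneOn_energy hB hKp hKd hσ Set.self_mem_Ici ht ht
  have h2 := S.kinetic_nonneg (q t) (v t)
  simp only at h1
  linarith

theorem tendsto_kinetic (h : S.IsMotion (S.controlLaw ξ Kp Kd σ qd) q v)
    (hB : ∀ q, S.ActuationCondition q) (hKp : 0 < Kp) (hKd : 0 < Kd) (hσ : 1 < σ) :
    Tendsto (fun t => S.kinetic (q t) (v t)) atTop (𝓝 0) := by
  obtain ⟨μ, L, hμ, hL, hb⟩ := h.exists_kinetic_bounds hB hKp hKd hσ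
  refine tendsto_zero_of_deriv_le_neg_mul (δ := Kd / L) (by positivity)
    (fun t _ => S.kinetic_nonneg _ _) (h.antitoneOn_kinetic hB hKp hKd hσ)
    (fun b hb => h.absolutelyContinuousOnInterval_kinetic le_rfl hb) ?_
  filter_upwards [h.ae_exists_deriv_kinetic_le hB hKp] with t ht hpos
  obtain ⟨d, h1, h2⟩ := ht hpos
  refine ⟨d, h1, h2.trans ?_⟩
  have h3 : 0 ≤ Kp * (σ - 1) * (‖q t - qd‖ * ‖v t‖) :=
    mul_nonneg (mul_nonneg hKp.le (by linarith)) (by positivity)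
  have h4 : Kd / L * S.kinetic (q t) (v t) ≤ Kd * ‖v t‖ ^ 2 := by
    calc Kd / L * S.kinetic (q t) (v t) ≤ Kd / L * (L * ‖v t‖ ^ 2) := by
          gcongr
          exact (hb t hpos.le).2
      _ = Kd * ‖v t‖ ^ 2 := by field_simp
  linarith

theorem tendsto_velocity (h : S.IsMotion (S.controlLaw ξ Kp Kd σ qd) q v)
    (hB : ∀ q, S.ActuationCondition q) (hKp : 0 < Kp) (hKd : 0 < Kd) (hσ : 1 < σ) :
    Tendsto v atTop (𝓝 0) := by
  obtain ⟨μ, L, hμ, hL, hb⟩ := h.exists_kinetic_bounds hB hKp hKd hσ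
  have hlim : Tendsto (fun t => √(S.kinetic (q t) (v t) / μ)) atTop (𝓝 0) := by
    simpa using ((h.tendsto_kinetic hB hKp hKd hσ).div_const μ).sqrt
  refine squeeze_zero_norm' ?_ hlim
  filter_upwards [eventually_ge_atTop 0] with t ht
  apply Real.le_sqrt_of_sq_le
  rw [le_div_iff₀ hμ]
  linarith [(hb t ht).1]

/-- A motion whose error stays away from zero comes to rest in finite time. -/
theorem exists_velocity_eq_zero (h : S.IsMotion (S.controlLaw ξ Kp Kd σ qd) q v)
    (hB : ∀ q, S.ActuationCondition q) (hKp : 0 < Kp) (hKd : 0 < Kd) (hσ : 1 < σ)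
    {r t₀ : ℝ} (hr : 0 < r) (ht₀ : 0 ≤ t₀) (he : ∀ t, t₀ ≤ t → r ≤ ‖q t - qd‖) :
    ∃ t₁, t₀ ≤ t₁ ∧ ∀ t, t₁ ≤ t → v t = 0 := by
  obtain ⟨μ, L, hμ, hL, hb⟩ := h.exists_kinetic_bounds hB hKp hKd hσ
  have hσ' : 0 < σ - 1 := by linarith
  -- The rate comes from `‖e‖ ≥ r` and `‖v‖ ≥ √T / √L`.
  obtain ⟨t₁, ht₁, hz⟩ := exists_eq_zero_of_deriv_le_neg_sqrt
    (f := fun t => S.kinetic (q t) (v t)) (t₀ := t₀) (δ := Kp * (σ - 1) * (r / √L))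
    (by positivity) (fun t _ => S.kinetic_nonneg _ _)
    (fun b hb => h.absolutelyContinuousOnInterval_kinetic ht₀ hb) (by
      filter_upwards [h.ae_exists_deriv_kinetic_le hB hKp] with t ht hgt
      have hpos : 0 < t := ht₀.trans_lt hgt
      obtain ⟨d, h1, h2⟩ := ht hpos
      refine ⟨d, h1, h2.trans ?_⟩
      have h3 : √(S.kinetic (q t) (v t)) ≤ √L * ‖v t‖ := by
        rw [← Real.sqrt_sq (norm_nonneg (v t)), ← Real.sqrt_mul hL.le]
        exact Real.sqrt_le_sqrt (hb t hpos.le).2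
      have h4 : r / √L * √(S.kinetic (q t) (v t)) ≤ ‖q t - qd‖ * ‖v t‖ := by
        calc r / √L * √(S.kinetic (q t) (v t)) ≤ r / √L * (√L * ‖v t‖) := by gcongr
          _ = r * ‖v t‖ := by field_simp
          _ ≤ ‖q t - qd‖ * ‖v t‖ := by
            gcongr
            exact he t hgt.le
      have h5 := mul_le_mul_of_nonneg_left h4 (mul_pos hKp hσ').le
      have h6 : 0 ≤ Kd * ‖v t‖ ^ 2 := by positivity
      linarith)
  refine ⟨t₁, ht₁, fun t ht => ?_⟩
  have h0 : 0 ≤ t₁ := ht₀.trans ht₁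
  have hle := h.antitoneOn_kinetic hB hKp hKd hσ h0 (h0.trans ht) ht
  simp only at hle hz
  have := (hb t (h0.trans ht)).1
  have h7 : ‖v t‖ ^ 2 ≤ 0 := by
    by_contra! hlt
    have := mul_pos hμ hlt
    linarith
  exact norm_eq_zero.mp (pow_eq_zero_iff two_ne_zero |>.mp (le_antisymm h7 (by positivity)))

theorem not_eventually_le_norm_error (h : S.IsMotion (S.controlLaw ξ Kp Kd σ qd) q v)
    (hB : ∀ q, S.ActuationCondition q) (hξ : ∀ q, ‖ξ q‖ = 1 ∧ ξ q ∈ nullSpace (S.A q))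
    (hKp : 0 < Kp) (hKd : 0 < Kd) (hσ : 1 < σ) {r : ℝ} (hr : 0 < r) :
    ¬ ∀ᶠ t in atTop, r ≤ ‖q t - qd‖ := by
  intro hev
  obtain ⟨s, hs⟩ := eventually_atTop.mp hev
  obtain ⟨t₁, ht₁, hrest⟩ := h.exists_velocity_eq_zero hB hKp hKd hσ hr (le_max_right s 0)
    fun t ht => hs t ((le_max_left _ _).trans ht)
  have h0 : 0 ≤ t₁ := (le_max_right s 0).trans ht₁
  have hdyn := (ae_restrict_iff' measurableSet_Ici).mp h.dynamics
  -- The equation holds only almost everywhere, but the rest phase has positive measure and so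
  -- contains a time where it holds.
  have hex : ∃ t, t₁ < t ∧ ∃ a fc : Vec n,
      HasDerivAt v a t ∧ fc ∈ (nullSpace (S.A (q t)))ᗮ ∧
        act (S.M (q t)) a + act (S.C (q t) (v t)) (v t) =
          S.fg (q t) + fc + S.controlLaw ξ Kp Kd σ qd (q t) (v t) := by
    by_contra! hno
    have hzero : volume (Set.Ioi t₁) = 0 := by
      refine measure_mono_null (fun t ht => ?_) (ae_iff.mp hdyn)
      intro hmem
      obtain ⟨a, fc, h1, h2, h3⟩ := hmem (h0.trans (le_of_lt ht))
      exact hno t ht a fc h1 h2 h3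
    simp at hzero
  obtain ⟨t, ht, a, fc, ha, hfc, heq⟩ := hex
  have hv0 : v =ᶠ[𝓝 t] fun _ => 0 := by
    filter_upwards [Ioi_mem_nhds ht] with u hu
    exact hrest u (le_of_lt hu)
  have ha0 : a = 0 := ha.unique ((hasDerivAt_const t (0 : Vec n)).congr_of_eventuallyEq hv0)
  rw [ha0, hv0.self_of_nhds, act, act, map_zero, map_zero, add_zero] at heq
  have hq := S.eq_target_of_equilibrium (hB _) (hξ _) hKp hσ hfc heq.symm
  have := hs t (((le_max_left s 0).trans ht₁).trans ht.le)
  rw [hq, sub_self, norm_zero] at this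
  linarith

theorem tendsto_config (h : S.IsMotion (S.controlLaw ξ Kp Kd σ qd) q v)
    (hB : ∀ q, S.ActuationCondition q) (hξ : ∀ q, ‖ξ q‖ = 1 ∧ ξ q ∈ nullSpace (S.A q))
    (hKp : 0 < Kp) (hKd : 0 < Kd) (hσ : 1 < σ) : Tendsto q atTop (𝓝 qd) := by
  obtain ⟨l, hl⟩ := exists_tendsto_of_antitoneOn_of_nonneg
    (fun t _ => add_nonneg (S.kinetic_nonneg (q t) (v t)) (by positivity))
    (h.antitoneOn_energy hB hKp hKd hσ)
  -- The error norm is recovered from the energy minus its kinetic part, both of which converge.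
  have hnorm : Tendsto (fun t => ‖q t - qd‖) atTop (𝓝 √((l - 0) / (Kp / 2))) := by
    refine (((hl.sub (h.tendsto_kinetic hB hKp hKd hσ)).div_const (Kp / 2)).sqrt).congr fun t => ?_
    rw [add_sub_cancel_left, mul_div_cancel_left₀ _ (by positivity), Real.sqrt_sq (norm_nonneg _)]
  rcases (Real.sqrt_nonneg ((l - 0) / (Kp / 2))).eq_or_lt with h0 | hpos
  · rw [← h0] at hnorm
    exact tendsto_iff_norm_sub_tendsto_zero.mpr hnorm
  · exact absurd ((hnorm.eventually_const_lt (half_lt_self hpos)).mono fun t ht => ht.le)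
      (h.not_eventually_le_norm_error hB hξ hKp hKd hσ (half_pos hpos))

end IsMotion

end ConstrainedSystem

end ConstrainedControl

theorem theorem2 {n m k : ℕ} (S : ConstrainedControl.ConstrainedSystem n m k)
    (hB : ∀ q, S.ActuationCondition q)
    (ξ : ConstrainedControl.Vec n → ConstrainedControl.Vec n)
    (hξ : ∀ q, ‖ξ q‖ = 1 ∧ ξ q ∈ ConstrainedControl.nullSpace (S.A q))
    (Kp Kd σ : ℝ) (hKp : 0 < Kp) (hKd : 0 < Kd) (hσ : 1 < σ)
    (qd : ConstrainedControl.Vec n) (q v : ℝ → ConstrainedControl.Vec n)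
    (hmotion : S.IsMotion (S.controlLaw ξ Kp Kd σ qd) q v) :
    Tendsto q atTop (𝓝 qd) ∧ Tendsto v atTop (𝓝 0) := by
  exact ⟨hmotion.tendsto_config hB hξ hKp hKd hσ, hmotion.tendsto_velocity hB hKp hKd hσ⟩
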